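/- Let $(X,d)$ be an unbounded complete metric space. Let $\mathrm{Con}(X)$ be the set $X\times(0,\infty)$ with the metric $$d_{\mathrm{Con}}\big((x,t),(x',t')\big)=2\log\frac{d(x,x')+\max\{t,t'\}}{\sqrt{tt'}}.$$ A roughly geodesic ray in a metric space $Y$ is a map $\xi:[0,\infty)\to Y$, not necessarily continuous, such that for some $C>0$ one has $|s-s'|-C\le d_Y(\xi(s),\xi(s'))\le |s-s'|+C$ for all $s,s'\ge 0$. Let $\partial_\infty Y$ be the set of roughly geodesic rays in $Y$, two rays being identified if (their images) are at finite Hausdorff distance from each other, and let $[\xi]$ denote the class of $\xi$. For $x,x_0\in X$ and $s\ge 0$ put $\gamma_x(s)=(x,e^{-s})$ and $\gamma_{\infty,x_0}(s)=(x_0,e^{s})$. These are geodesic rays in $\mathrm{Con}(X)$, and the class $[\gamma_\infty]:=[\gamma_{\infty,x_0}]$ does not depend on $x_0$. Suppose that there are a real number $a>1$, a bijection $\alpha:X\to X$ with $d(\alpha x,\alpha y)=a\,d(x,y)$ for all $x,y\in X$, and a compact set $K\subset X$ such that $\bigcup_{n\in\mathbb Z}\alpha^nK=X$. Then the map $$\iota:X\cup\{\infty\}\to\partial_\infty\mathrm{Con}(X),\qquad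 \iota(x)=[\gamma_x]\ (x\in X),\quad \iota(\infty)=[\gamma_\infty],$$ is a bijection. -/

import Mathlib

open scoped NNReal

/-- A `C`-rough isometry: distances are preserved up to an additive error `C`
(no continuity, no surjectivity). -/
def IsRoughIsometry {X Y : Type*} [MetricSpace X] [MetricSpace Y] (C : ℝ) (f : X → Y) : Prop :=
  ∀ x y : X, -C + dist x y ≤ dist (f x) (f y) ∧ dist (f x) (f y) ≤ dist x y + C

/-- A roughly geodesic ray in `Y`: a `C`-rough isometry `[0, ∞) → Y` for some `C > 0`. -/
structure RoughRay (Y : Type*) [MetricSpace Y] where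
  toFun : ℝ≥0 → Y
  rough : ∃ C : ℝ, 0 < C ∧ IsRoughIsometry C toFun

/-- Two roughly geodesic rays are equivalent if (their images) are at finite Hausdorff distance. -/
def RoughRay.Equivalent {Y : Type*} [MetricSpace Y] (ξ ζ : RoughRay Y) : Prop :=
  Metric.hausdorffEDist (Set.range ξ.toFun) (Set.range ζ.toFun) < ⊤

instance RoughRay.setoid (Y : Type*) [MetricSpace Y] : Setoid (RoughRay Y) where
  r := RoughRay.Equivalent
  iseqv :=
    { refl := fun ξ => by simp [RoughRay.Equivalent]
      symm := fun {ξ ζ} h => by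
        unfold RoughRay.Equivalent at *
        rwa [Metric.hausdorffEDist_comm]
      trans := fun {ξ ζ η} h h' =>
        lt_of_le_of_lt Metric.hausdorffEDist_triangle (ENNReal.add_lt_top.2 ⟨h, h'⟩) }

/-- The boundary at infinity `∂_∞ Y`: roughly geodesic rays up to finite Hausdorff distance. -/
def BoundaryAtInfinity (Y : Type*) [MetricSpace Y] : Type _ := Quotient (RoughRay.setoid Y)

/-- The class `[ξ] ∈ ∂_∞ Y` of a roughly geodesic ray. -/
def RoughRay.toBoundary {Y : Type*} [MetricSpace Y] (ξ : RoughRay Y) : BoundaryAtInfinity Y :=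
  Quotient.mk (RoughRay.setoid Y) ξ

/-- The underlying set `X × (0, ∞)` of `Con(X)`, for a metric space `X` of infinite diameter. -/
@[ext]
structure HypCon (X : Type*) where
  base : X
  height : ℝ
  height_pos : 0 < height

namespace HypCon

/-- `d((x,t),(x',t')) = 2 log ((d(x,x') + max t t') / √(t t'))`. -/
noncomputable def conDist {X : Type*} [MetricSpace X] (p q : HypCon X) : ℝ :=
  2 * Real.log ((dist p.base q.base + max p.height q.height) / Real.sqrt (p.height * q.height))

theorem conDist_eq {X : Type*} [MetricSpace X] (p q : HypCon X) :
    conDist p q = 2 * Real.log (dist p.base q.base + max p.height q.height)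
      - Real.log p.height - Real.log q.height := by
  have hp := p.height_pos
  have hq := q.height_pos
  have hm : 0 < max p.height q.height := lt_max_of_lt_left hp
  have hd : 0 ≤ dist p.base q.base := dist_nonneg
  unfold conDist
  rw [Real.log_div (by positivity) (by positivity), Real.log_sqrt (by positivity),
    Real.log_mul hp.ne' hq.ne']
  ring

theorem conDist_self {X : Type*} [MetricSpace X] (p : HypCon X) : conDist p p = 0 := by
  rw [conDist_eq]
  simp
  ring

theorem conDist_comm {X : Type*} [MetricSpace X] (p q : HypCon X) :
    conDist p q = conDist q p := by
  rw [conDist_eq, conDist_eq, dist_comm, max_comm]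
  ring

theorem conDist_triangle {X : Type*} [MetricSpace X] (p q r : HypCon X) :
    conDist p r ≤ conDist p q + conDist q r := by
  have hp := p.height_pos
  have hq := q.height_pos
  have hr := r.height_pos
  have ha : 0 ≤ dist p.base q.base := dist_nonneg
  have hb : 0 ≤ dist q.base r.base := dist_nonneg
  have hc : 0 ≤ dist p.base r.base := dist_nonneg
  have htri := dist_triangle p.base q.base r.base
  have h1 : q.height ≤ max p.height q.height := le_max_right _ _
  have h1' : p.height ≤ max p.height q.height := le_max_left _ _
  have h2 : q.height ≤ max q.height r.height := le_max_left _ _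
  have h2' : r.height ≤ max q.height r.height := le_max_right _ _
  have hM : max p.height r.height * q.height ≤
      max p.height q.height * max q.height r.height := by
    rcases max_choice p.height r.height with h | h <;> rw [h]
    · exact mul_le_mul h1' h2 hq.le (hp.le.trans h1')
    · rw [mul_comm]
      exact mul_le_mul h1 h2' hr.le (hp.le.trans h1')
  have hm : 0 < max p.height r.height := lt_max_of_lt_left hp
  have key : (dist p.base r.base + max p.height r.height) * q.height ≤
      (dist p.base q.base + max p.height q.height) *
        (dist q.base r.base + max q.height r.height) := by
    nlinarith [mul_le_mul_of_nonneg_left h2 ha, mul_le_mul_of_nonneg_left h1 hb,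
      mul_nonneg ha hb, mul_le_mul_of_nonneg_right htri hq.le]
  have hl := Real.log_le_log (by positivity) key
  rw [Real.log_mul (by positivity) hq.ne', Real.log_mul (by positivity) (by positivity)] at hl
  rw [conDist_eq, conDist_eq, conDist_eq]
  linarith

theorem eq_of_conDist_eq_zero {X : Type*} [MetricSpace X] {p q : HypCon X}
    (h : conDist p q = 0) : p = q := by
  have hp := p.height_pos
  have hq := q.height_pos
  have hd : 0 ≤ dist p.base q.base := dist_nonneg
  have hm1 : p.height ≤ max p.height q.height := le_max_left _ _
  have hm2 : q.height ≤ max p.height q.height := le_max_right _ _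
  have hm : 0 < max p.height q.height := lt_max_of_lt_left hp
  rw [conDist_eq] at h
  have hlog : Real.log ((dist p.base q.base + max p.height q.height) ^ 2) =
      Real.log (p.height * q.height) := by
    rw [Real.log_pow, Real.log_mul hp.ne' hq.ne']
    push_cast
    linarith
  have heq := Real.log_injOn_pos (Set.mem_Ioi.2 (by positivity))
    (Set.mem_Ioi.2 (by positivity)) hlog
  have hd0 : dist p.base q.base = 0 := by nlinarith
  rw [hd0, zero_add] at heq
  have hh : p.height = q.height := by
    rcases max_choice p.height q.height with h' | h' <;> rw [h'] at heq <;> nlinarith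
  exact HypCon.ext (dist_eq_zero.1 hd0) hh

/-- The metric space `Con(X)`. -/
noncomputable instance {X : Type*} [MetricSpace X] : MetricSpace (HypCon X) where
  dist := conDist
  dist_self := conDist_self
  dist_comm := conDist_comm
  dist_triangle := conDist_triangle
  eq_of_dist_eq_zero := eq_of_conDist_eq_zero

/-- The ray `γ_x(s) = (x, e^{-s})`, `s ≥ 0`. -/
noncomputable def downRayFun {X : Type*} (x : X) (s : ℝ≥0) : HypCon X :=
  ⟨x, Real.exp (-(s : ℝ)), Real.exp_pos _⟩

/-- The ray `γ_{∞,x₀}(s) = (x₀, e^s)`, `s ≥ 0`. -/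
noncomputable def upRayFun {X : Type*} (x₀ : X) (s : ℝ≥0) : HypCon X :=
  ⟨x₀, Real.exp (s : ℝ), Real.exp_pos _⟩

theorem dist_downRayFun {X : Type*} [MetricSpace X] (x : X) (s t : ℝ≥0) :
    dist (downRayFun x s) (downRayFun x t) = dist s t := by
  change conDist _ _ = _
  rw [conDist_eq, NNReal.dist_eq]
  simp only [downRayFun, dist_self, zero_add, Real.log_exp]
  rcases le_total (s : ℝ) t with h | h
  · rw [max_eq_left (Real.exp_le_exp.2 (by linarith)), Real.log_exp,
      abs_of_nonpos (by linarith)]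
    ring
  · rw [max_eq_right (Real.exp_le_exp.2 (by linarith)), Real.log_exp,
      abs_of_nonneg (by linarith)]
    ring

theorem dist_upRayFun {X : Type*} [MetricSpace X] (x : X) (s t : ℝ≥0) :
    dist (upRayFun x s) (upRayFun x t) = dist s t := by
  change conDist _ _ = _
  rw [conDist_eq, NNReal.dist_eq]
  simp only [upRayFun, dist_self, zero_add, Real.log_exp]
  rcases le_total (s : ℝ) t with h | h
  · rw [max_eq_right (Real.exp_le_exp.2 h), Real.log_exp, abs_of_nonpos (by linarith)]
    ring
  · rw [max_eq_left (Real.exp_le_exp.2 h), Real.log_exp, abs_of_nonneg (by linarith)]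
    ring

/-- `γ_x` as a (roughly) geodesic ray of `Con(X)`. -/
noncomputable def downRay {X : Type*} [MetricSpace X] (x : X) : RoughRay (HypCon X) where
  toFun := downRayFun x
  rough := ⟨1, one_pos, fun s t => by
    rw [dist_downRayFun]
    constructor <;> linarith⟩

/-- `γ_{∞,x₀}` as a (roughly) geodesic ray of `Con(X)`. -/
noncomputable def upRay {X : Type*} [MetricSpace X] (x₀ : X) : RoughRay (HypCon X) where
  toFun := upRayFun x₀
  rough := ⟨1, one_pos, fun s t => by
    rw [dist_upRayFun]
    constructor <;> linarith⟩

/-- The class `[γ_{∞,x₀}]` does not depend on `x₀`. -/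
theorem upRay_toBoundary_eq {X : Type*} [MetricSpace X] (x₀ x₁ : X) :
    (upRay x₀).toBoundary = (upRay x₁).toBoundary := by
  have hb : ∀ (x y : X) (s : ℝ≥0), edist (upRayFun x s) (upRayFun y s) ≤
      ENNReal.ofReal (2 * Real.log (dist x y + 1)) := by
    intro x y s
    rw [edist_dist]
    apply ENNReal.ofReal_le_ofReal
    change conDist _ _ ≤ _
    have hd : 0 ≤ dist x y := dist_nonneg
    have hs : 1 ≤ Real.exp (s : ℝ) := Real.one_le_exp s.2
    have h : Real.log (dist x y + Real.exp s) ≤ Real.log (dist x y + 1) + s := by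
      rw [← Real.log_exp (s : ℝ), Real.exp_log (Real.exp_pos _),
        ← Real.log_mul (by positivity) (by positivity)]
      apply Real.log_le_log (by positivity)
      nlinarith
    rw [conDist_eq]
    simp only [upRayFun, max_self, Real.log_exp]
    linarith
  refine Quotient.sound (s := RoughRay.setoid (HypCon X)) ?_
  change Metric.hausdorffEDist _ _ < ⊤
  refine lt_of_le_of_lt (Metric.hausdorffEDist_le_of_mem_edist
    (r := ENNReal.ofReal (2 * Real.log (dist x₀ x₁ + 1))) ?_ ?_) ENNReal.ofReal_lt_top
  · rintro _ ⟨s, rfl⟩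
    exact ⟨_, ⟨s, rfl⟩, hb x₀ x₁ s⟩
  · rintro _ ⟨s, rfl⟩
    refine ⟨_, ⟨s, rfl⟩, ?_⟩
    rw [dist_comm]
    exact hb x₁ x₀ s

/-- The map `ι : X ∪ {∞} → ∂_∞ Con(X)`, `x ↦ [γ_x]`, `∞ ↦ [γ_∞] = [γ_{∞,x₀}]`; the base point
`x₀` only serves to name a representative of `[γ_∞]`, see `upRay_toBoundary_eq`. -/
noncomputable def boundaryMap {X : Type*} [MetricSpace X] (x₀ : X) :
    OnePoint X → BoundaryAtInfinity (HypCon X)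
  | OnePoint.some x => (downRay x).toBoundary
  | OnePoint.infty => (upRay x₀).toBoundary

end HypCon

/-! In `Con(X)` the distance is `2 log span` minus the two log-heights, so everything reduces to the
growth of `span` along a ray. Injectivity follows from lower bounds for `span` by the base distance
or by a height. For surjectivity, let `L s` be the log of the span between `ξ 0` and `ξ s`. If `L`
is bounded, roughness forces log-height `-s + O(1)`; the base points are then Cauchy at an
exponential rate, and by completeness the ray follows `γ_x` for their limit `x`
(`exists_equivalent_downRay`). If `L` is unbounded, comparison with a much later point forces `L s =
s + O(1)`, hence log-height `s + O(1)`, and the ray follows `γ_∞` (`equivalent_upRay_of_unbounded`).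
-/

theorem RoughRay.equivalent_of_dist_le {Y : Type*} [MetricSpace Y] {ξ ζ : RoughRay Y} {M : ℝ}
    (h : ∀ s, dist (ξ.toFun s) (ζ.toFun s) ≤ M) : ξ.Equivalent ζ := by
  refine lt_of_le_of_lt (Metric.hausdorffEDist_le_of_mem_edist
    (r := ENNReal.ofReal M) ?_ ?_) ENNReal.ofReal_lt_top
  · rintro _ ⟨s, rfl⟩
    refine ⟨_, ⟨s, rfl⟩, ?_⟩
    rw [edist_dist]
    exact ENNReal.ofReal_le_ofReal (h s)
  · rintro _ ⟨s, rfl⟩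
    refine ⟨_, ⟨s, rfl⟩, ?_⟩
    rw [edist_comm, edist_dist]
    exact ENNReal.ofReal_le_ofReal (h s)

theorem RoughRay.Equivalent.exists_dist_le {Y : Type*} [MetricSpace Y] {ξ ζ : RoughRay Y}
    (h : ξ.Equivalent ζ) : ∃ M : ℝ, ∀ s, ∃ t, dist (ξ.toFun s) (ζ.toFun t) ≤ M := by
  obtain ⟨M, -, hM⟩ := ENNReal.lt_iff_exists_real_btwn.1 h
  refine ⟨M, fun s => ?_⟩
  obtain ⟨_, ⟨t, rfl⟩, ht⟩ :=
    Metric.exists_edist_lt_of_hausdorffEDist_lt (Set.mem_range_self (f := ξ.toFun) s) hM.1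
  refine ⟨t, ?_⟩
  have hpos : 0 < ENNReal.ofReal M := lt_of_le_of_lt bot_le ht
  rw [edist_dist] at ht
  exact ((ENNReal.ofReal_lt_ofReal_iff (ENNReal.ofReal_pos.1 hpos)).1 ht).le

theorem RoughRay.toBoundary_eq_iff {Y : Type*} [MetricSpace Y] {ξ ζ : RoughRay Y} :
    ξ.toBoundary = ζ.toBoundary ↔ ξ.Equivalent ζ :=
  Quotient.eq (r := RoughRay.setoid Y)

namespace HypCon

variable {X : Type*} [MetricSpace X]

/-- The quantity `d(x, x') + max t t'` whose logarithm governs the distance of `Con(X)`. -/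
noncomputable def span (p q : HypCon X) : ℝ :=
  dist p.base q.base + max p.height q.height

theorem height_le_span_left (p q : HypCon X) : p.height ≤ span p q :=
  le_add_of_nonneg_of_le dist_nonneg (le_max_left _ _)

theorem height_le_span_right (p q : HypCon X) : q.height ≤ span p q :=
  le_add_of_nonneg_of_le dist_nonneg (le_max_right _ _)

theorem span_pos (p q : HypCon X) : 0 < span p q :=
  p.height_pos.trans_le (height_le_span_left p q)

theorem span_comm (p q : HypCon X) : span p q = span q p := by
  rw [span, span, dist_comm, max_comm]

theorem dist_base_le_span (p q : HypCon X) : dist p.base q.base ≤ span p q :=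
  le_add_of_nonneg_right (p.height_pos.le.trans (le_max_left _ _))

theorem span_triangle (p q r : HypCon X) : span p r ≤ span p q + span q r := by
  have h := dist_triangle p.base q.base r.base
  have h1 : max p.height r.height ≤ max p.height q.height + max q.height r.height := by
    have hq := q.height_pos
    have := le_max_left p.height q.height
    have := le_max_right p.height q.height
    have := le_max_left q.height r.height
    have := le_max_right q.height r.height
    exact max_le (by linarith) (by linarith)
  unfold span
  linarith

theorem dist_eq_log_span (p q : HypCon X) :
    dist p q = 2 * Real.log (span p q) - Real.log p.height - Real.log q.height :=
  conDist_eq p q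

theorem log_span_le_of_le_exp {p q : HypCon X} {u : ℝ} (h : span p q ≤ Real.exp u) :
    Real.log (span p q) ≤ u :=
  (Real.log_le_iff_le_exp (span_pos p q)).2 h

/-! ### Injectivity -/

theorem downRay_injective {x y : X} (h : (downRay x).Equivalent (downRay y)) : x = y := by
  obtain ⟨M, hM⟩ := h.exists_dist_le
  by_contra hxy
  have hd : 0 < dist x y := dist_pos.2 hxy
  -- For every `t` the distance is at least `2 log d(x,y) + s + t`, which exceeds `M` for this `s`.
  obtain ⟨s, hs⟩ := exists_gt (Real.toNNReal (M - 2 * Real.log (dist x y)))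
  obtain ⟨t, ht⟩ := hM s
  have hs' := (Real.le_coe_toNNReal _).trans_lt (NNReal.coe_lt_coe.2 hs)
  have h1 := Real.log_le_log hd (dist_base_le_span (downRayFun x s) (downRayFun y t))
  change dist (downRayFun x s) (downRayFun y t) ≤ M at ht
  rw [dist_eq_log_span] at ht
  have h2 : Real.log (downRayFun x s).height = -s := Real.log_exp _
  have h3 : Real.log (downRayFun y t).height = -t := Real.log_exp _
  linarith [t.coe_nonneg]

/-- The span is at least `e^s`, so the distance is at least `2s - s + t ≥ s` for every `t`. -/
theorem not_upRay_equivalent_downRay (x₀ x : X) : ¬ (upRay x₀).Equivalent (downRay x) := by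
  intro h
  obtain ⟨M, hM⟩ := h.exists_dist_le
  obtain ⟨s, hs⟩ := exists_gt (Real.toNNReal M)
  obtain ⟨t, ht⟩ := hM s
  have hs' := (Real.le_coe_toNNReal _).trans_lt (NNReal.coe_lt_coe.2 hs)
  have h1 := Real.log_le_log (upRayFun x₀ s).height_pos
    (height_le_span_left (upRayFun x₀ s) (downRayFun x t))
  change dist (upRayFun x₀ s) (downRayFun x t) ≤ M at ht
  rw [dist_eq_log_span] at ht
  have h2 : Real.log (upRayFun x₀ s).height = s := Real.log_exp _
  have h3 : Real.log (downRayFun x t).height = -t := Real.log_exp _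
  linarith [t.coe_nonneg]

theorem boundaryMap_injective (x₀ : X) : Function.Injective (boundaryMap x₀) := by
  intro p q h
  induction p using OnePoint.rec with
  | infty =>
    induction q using OnePoint.rec with
    | infty => rfl
    | coe y => exact absurd (RoughRay.toBoundary_eq_iff.1 h) (not_upRay_equivalent_downRay x₀ y)
  | coe x =>
    induction q using OnePoint.rec with
    | infty =>
      exact absurd (RoughRay.toBoundary_eq_iff.1 h.symm) (not_upRay_equivalent_downRay x₀ x)
    | coe y => exact congrArg _ (downRay_injective (RoughRay.toBoundary_eq_iff.1 h))

/-! ### Surjectivity: the dichotomy for rough rays -/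

/-- A rough ray staying at bounded span from its origin descends to a point of `X`. -/
theorem exists_equivalent_downRay [CompleteSpace X] (ξ : RoughRay (HypCon X)) {M : ℝ}
    (hM : ∀ s, Real.log (span (ξ.toFun 0) (ξ.toFun s)) ≤ M) :
    ∃ x : X, ξ.Equivalent (downRay x) := by
  obtain ⟨C, hC, hξ⟩ := ξ.rough
  set f := ξ.toFun
  set h : ℝ≥0 → ℝ := fun s => Real.log (f s).height with hdef
  -- Solve the roughness inequality between times `0` and `s` for `h s`, using `h 0 ≤ log span ≤ M`.
  have hheight : ∃ B : ℝ, 0 ≤ B ∧ ∀ s : ℝ≥0, h s ≤ -s + B ∧ -s - B ≤ h s := by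
    refine ⟨|2 * M - h 0 + C| + |h 0 - C|, by positivity, fun s => ?_⟩
    obtain ⟨h1, h2⟩ := hξ 0 s
    rw [dist_eq_log_span, dist_comm, NNReal.dist_eq, NNReal.coe_zero, sub_zero,
      abs_of_nonneg s.coe_nonneg] at h1 h2
    have h3 := Real.log_le_log (f 0).height_pos (height_le_span_left (f 0) (f s))
    have h4 := hM s
    have := le_abs_self (2 * M - h 0 + C)
    have := neg_abs_le (h 0 - C)
    have := abs_nonneg (2 * M - h 0 + C)
    have := abs_nonneg (h 0 - C)
    simp only [hdef] at *
    constructor <;> linarith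
  obtain ⟨B, hB0, hB⟩ := hheight
  -- In `2 log span ≤ (s - r) + C + h r + h s` the later time `s` cancels against `h s ≤ -s + B`.
  have hspan : ∀ r s : ℝ≥0, r ≤ s → span (f r) (f s) ≤ Real.exp (-r + (C / 2 + B)) := by
    intro r s hrs
    obtain ⟨-, h2⟩ := hξ r s
    rw [dist_eq_log_span, dist_comm, NNReal.dist_eq,
      abs_of_nonneg (sub_nonneg.2 (NNReal.coe_le_coe.2 hrs))] at h2
    have h3 := (hB r).1
    have h4 := (hB s).1
    simp only [hdef] at h3 h4
    rw [← Real.log_le_iff_le_exp (span_pos _ _)]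
    linarith
  have hdist : ∀ r s N : ℝ≥0, N ≤ r → N ≤ s →
      dist (f r).base (f s).base ≤ Real.exp (-N + (C / 2 + B)) := by
    have aux : ∀ r s N : ℝ≥0, N ≤ r → r ≤ s →
        dist (f r).base (f s).base ≤ Real.exp (-N + (C / 2 + B)) := fun r s N hN hrs =>
      (dist_base_le_span _ _).trans ((hspan r s hrs).trans (Real.exp_le_exp.2 (by
        have := NNReal.coe_le_coe.2 hN
        linarith)))
    intro r s N hr hs
    rcases le_total r s with hrs | hrs
    · exact aux r s N hr hrs
    · rw [dist_comm]
      exact aux s r N hs hrs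
  have hlim : Filter.Tendsto (fun N : ℝ≥0 => Real.exp (-(N : ℝ) + (C / 2 + B))) Filter.atTop
      (nhds 0) :=
    Real.tendsto_exp_atBot.comp (Filter.tendsto_atBot_add_const_right _ _
      (Filter.tendsto_neg_atTop_atBot.comp (NNReal.tendsto_coe_atTop.2 Filter.tendsto_id)))
  obtain ⟨x, hx⟩ := cauchySeq_tendsto_of_complete
    (cauchySeq_of_le_tendsto_0 (s := fun s => (f s).base) _ hdist hlim)
  have hxs : ∀ s : ℝ≥0, dist (f s).base x ≤ Real.exp (-s + (C / 2 + B)) := fun s =>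
    le_of_tendsto (tendsto_const_nhds.dist hx)
      ((Filter.eventually_ge_atTop s).mono fun r hr => hdist s r s le_rfl hr)
  refine ⟨x, RoughRay.equivalent_of_dist_le (M := 2 * (C / 2 + B + Real.log 2) + B) fun s => ?_⟩
  change dist (f s) (downRayFun x s) ≤ _
  have h5 := hB s
  have h6 : Real.log (downRayFun x s).height = -s := Real.log_exp _
  have h7 : max (f s).height (downRayFun x s).height ≤ Real.exp (-s + (C / 2 + B)) := by
    refine max_le ?_ (Real.exp_le_exp.2 (by linarith))
    rw [← Real.log_le_iff_le_exp (f s).height_pos]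
    have := h5.1
    simp only [hdef] at this
    linarith
  have h8 : Real.log (span (f s) (downRayFun x s)) ≤ -s + (C / 2 + B) + Real.log 2 := by
    apply log_span_le_of_le_exp
    rw [Real.exp_add _ (Real.log 2), Real.exp_log two_pos]
    have := hxs s
    change dist (f s).base x + max (f s).height (downRayFun x s).height ≤ _
    linarith
  have h9 := h5.2
  simp only [hdef] at h9
  rw [dist_eq_log_span]
  linarith

/-- A rough ray whose span from its origin is unbounded converges to `∞`. -/
theorem equivalent_upRay_of_unbounded (ξ : RoughRay (HypCon X))
    (hM : ∀ M : ℝ, ∃ s, M < Real.log (span (ξ.toFun 0) (ξ.toFun s))) :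
    ξ.Equivalent (upRay (ξ.toFun 0).base) := by
  obtain ⟨C, hC, hξ⟩ := ξ.rough
  set f := ξ.toFun
  set h : ℝ≥0 → ℝ := fun s => Real.log (f s).height with hdef
  set L : ℝ≥0 → ℝ := fun s => Real.log (span (f 0) (f s))
  have horigin : ∀ s : ℝ≥0, -C + s ≤ 2 * L s - h 0 - h s ∧ 2 * L s - h 0 - h s ≤ s + C := by
    intro s
    have h1 := hξ 0 s
    rwa [dist_eq_log_span, dist_comm, NNReal.dist_eq, NNReal.coe_zero, sub_zero,
      abs_of_nonneg s.coe_nonneg] at h1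
  have hhL : ∀ s, h s ≤ L s := fun s =>
    Real.log_le_log (f s).height_pos (height_le_span_right (f 0) (f s))
  have hupper : ∀ s : ℝ≥0, L s ≤ s + C + h 0 := fun s => by
    linarith [(horigin s).2, hhL s]
  -- The lower bound comes from roughness on the pairs `(0,s)`, `(0,r)`, `(s,r)` with `r` far out:
  -- `L r` cancels, leaving three errors `C` and two `log 2`, then halved.
  have hL : ∀ s : ℝ≥0, s - (3 * C / 2 + Real.log 2 + |h 0|) ≤ L s ∧
      L s ≤ s + (3 * C / 2 + Real.log 2 + |h 0|) := by
    intro s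
    have hlog2 : 0 < Real.log 2 := Real.log_pos one_lt_two
    refine ⟨?_, by linarith [hupper s, le_abs_self (h 0)]⟩
    -- The first entry forces `s ≤ r` through `hupper`; the second makes the span to `f r` at least
    -- twice that to `f s`, so the triangle inequality leaves at least half of it between `f s` and
    -- `f r`.
    obtain ⟨r, hr⟩ := hM (max (s + C + h 0) (L s + Real.log 2))
    obtain ⟨hr1, hr2⟩ := max_lt_iff.1 hr
    have hsr : (s : ℝ) ≤ r := by linarith [hupper r]
    have h2 := (hξ s r).2
    rw [dist_eq_log_span, dist_comm, NNReal.dist_eq, abs_of_nonneg (sub_nonneg.2 hsr)] at h2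
    have h1 : L r ≤ Real.log 2 + Real.log (span (f s) (f r)) := by
      have h3 := span_triangle (f 0) (f s) (f r)
      have h4 : 2 * span (f 0) (f s) ≤ span (f 0) (f r) := by
        have := span_pos (f 0) (f s)
        rw [← Real.log_le_log_iff (by positivity) (span_pos _ _),
          Real.log_mul two_ne_zero this.ne']
        linarith
      rw [← Real.log_mul two_ne_zero (span_pos _ _).ne']
      exact Real.log_le_log (span_pos _ _) (by linarith)
    have h5 := (horigin s).1
    have h6 := (horigin r).1
    have := neg_abs_le (h 0)
    simp only [hdef] at *
    linarith
  set A : ℝ := 3 * C / 2 + Real.log 2 + |h 0| with hA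
  have hA0 : 0 ≤ A := by
    have hlog2 : 0 < Real.log 2 := Real.log_pos one_lt_two
    positivity
  refine RoughRay.equivalent_of_dist_le (M := 2 * (A + Real.log 2) + (2 * A + |h 0| + C))
    fun s => ?_
  change dist (f s) (upRayFun (f 0).base s) ≤ _
  have hS : span (f 0) (f s) ≤ Real.exp (s + A) := by
    rw [← Real.log_le_iff_le_exp (span_pos _ _)]
    exact (hL s).2
  have h6 : Real.log (upRayFun (f 0).base s).height = s := Real.log_exp _
  have h7 : max (f s).height (upRayFun (f 0).base s).height ≤ Real.exp (s + A) :=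
    max_le ((height_le_span_right _ _).trans hS) (Real.exp_le_exp.2 (by linarith))
  have h8 : Real.log (span (f s) (upRayFun (f 0).base s)) ≤ s + A + Real.log 2 := by
    apply log_span_le_of_le_exp
    rw [Real.exp_add _ (Real.log 2), Real.exp_log two_pos]
    have := (dist_base_le_span (f 0) (f s)).trans hS
    rw [dist_comm] at this
    change dist (f s).base (f 0).base + max (f s).height (upRayFun (f 0).base s).height ≤ _
    linarith
  -- Roughness gives `h s ≥ 2 L s - h 0 - s - C`, and `L s ≥ s - A`.
  have h9 : s - (2 * A + |h 0| + C) ≤ h s := by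
    linarith [(horigin s).2, (hL s).1, le_abs_self (h 0)]
  rw [dist_eq_log_span]
  simp only [hdef] at *
  linarith

theorem boundaryMap_surjective [CompleteSpace X] (x₀ : X) :
    Function.Surjective (boundaryMap x₀) := by
  intro b
  obtain ⟨ξ, rfl⟩ := Quotient.exists_rep b
  change ∃ p, boundaryMap x₀ p = ξ.toBoundary
  by_cases hM : ∃ M : ℝ, ∀ s, Real.log (span (ξ.toFun 0) (ξ.toFun s)) ≤ M
  · obtain ⟨M, hM⟩ := hM
    obtain ⟨x, hx⟩ := exists_equivalent_downRay ξ hM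
    exact ⟨OnePoint.some x, (RoughRay.toBoundary_eq_iff.2 hx).symm⟩
  · push Not at hM
    exact ⟨OnePoint.infty, (upRay_toBoundary_eq x₀ _).trans
      (RoughRay.toBoundary_eq_iff.2 (equivalent_upRay_of_unbounded ξ hM)).symm⟩

end HypCon

theorem mainTheorem6 {X : Type*} [MetricSpace X] [CompleteSpace X]
    (hX : ¬ Bornology.IsBounded (Set.univ : Set X))
    (a : ℝ) (ha : 1 < a) (α : Equiv.Perm X)
    (hα : ∀ x y : X, dist (α x) (α y) = a * dist x y)
    (K : Set X) (hK : IsCompact K)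
    (hcover : ⋃ n : ℤ, (fun x : X => (α ^ n) x) '' K = Set.univ)
    (x₀ : X) :
    Function.Bijective (HypCon.boundaryMap x₀) :=
  ⟨HypCon.boundaryMap_injective x₀, HypCon.boundaryMap_surjective x₀⟩
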